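/- Let $(V,d)$ be a metric space and let $k\ge 1$ be an integer. A configuration is a subset $X\subseteq V$ with $|X|=k$ (the positions of the $k$ servers), and the distance $D(X,Y)$ between two configurations is the minimum weight of a perfect matching between $X$ and $Y$. For an initial configuration $A_0$ and a finite request sequence $\rho=r_1\cdots r_n$ of points of $V$, the work function $w_\rho(X)$ is the optimal cost of serving $\rho$ starting in $A_0$ and ending up in $X$, that is, the infimum of $\sum_{i=0}^{n}D(C_i,C_{i+1})$ over all sequences of configurations with $C_0=A_0$, $r_i\in C_i$ for $1\le i\le n$, and $C_{n+1}=X$; and $\mathrm{OPT}(A_0,\rho)=\inf_X w_\rho(X)$. The Work Function Algorithm (WFA) starts in $A_0$; when it is in configuration $X$ after having served $\rho$ and the next request is $r$, it moves to $r$ a server from a point $a\in X$ such that $w_\rho(X\setminus\{a\}\cup\{r\})+d(a,r)$ is minimal among all $a\in X$ for which $X\setminus\{a\}\cup\{r\}$ is a configuration (so that it does not move if $r\in X$), ties being broken by an arbitrary deterministic rule. Let $\mathrm{WFA}(A_0,\rho)$ be the sum of the distances $D$ between the successive configurations that the algorithm occupies while serving $\rho$ starting in $A_0$. Then the Work Function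 Algorithm is strictly $(4k-2)$-competitive: for every initial configuration $A_0$ and every finite request sequence $\rho$, $$\mathrm{WFA}(A_0,\rho)\le(4k-2)\cdot\mathrm{OPT}(A_0,\rho).$$ -/

import Mathlib

namespace KServer

/-- A configuration of `k` servers: a set of exactly `k` points of `V`. -/
abbrev Config (V : Type*) (k : ℕ) : Type _ := {X : Finset V // X.card = k}

/-- The distance between two configurations: the minimum weight of a perfect matching
between them (an infimum over a finite non-empty set of matchings). -/
noncomputable def configDist {V : Type*} [MetricSpace V] {k : ℕ} (X Y : Config V k) : ℝ :=
  ⨅ e : {x // x ∈ X.1} ≃ {y // y ∈ Y.1}, ∑ x : {x // x ∈ X.1}, dist (x : V) (e x : V)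

/-- `C 0, C 1, …, C (n + 1)`, where `n` is the length of `ρ`, is an (offline) execution that
starts in `A₀`, has a server on the `i`-th request when the `i`-th round is served, and after
the last round ends up in `X` (entries of `C` beyond index `n + 1` are irrelevant). -/
def IsExecution {V : Type*} {k : ℕ} (A₀ : Config V k) (ρ : List V) (X : Config V k)
    (C : ℕ → Config V k) : Prop :=
  C 0 = A₀ ∧ (∀ (i : ℕ) (hi : i < ρ.length), ρ[i] ∈ (C (i + 1)).1) ∧ C (ρ.length + 1) = X

/-- The total movement cost of the first `n` steps of a sequence of configurations. -/
noncomputable def moveCost {V : Type*} [MetricSpace V] {k : ℕ} (C : ℕ → Config V k)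
    (n : ℕ) : ℝ :=
  ∑ i ∈ Finset.range n, configDist (C i) (C (i + 1))

/-- The work function: the optimal cost of serving `ρ` starting in `A₀` and ending up in `X`. -/
noncomputable def workFunction {V : Type*} [MetricSpace V] {k : ℕ} (A₀ : Config V k)
    (ρ : List V) (X : Config V k) : ℝ :=
  sInf {c : ℝ | ∃ C : ℕ → Config V k, IsExecution A₀ ρ X C ∧ moveCost C (ρ.length + 1) = c}

/-- The optimal (offline) cost of serving `ρ` starting in `A₀`. -/
noncomputable def optCost {V : Type*} [MetricSpace V] {k : ℕ} (A₀ : Config V k)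
    (ρ : List V) : ℝ :=
  ⨅ X : Config V k, workFunction A₀ ρ X

/-- A deterministic online algorithm for the `k`-server problem: the configuration that it
occupies is a function of the initial configuration and of the requests presented so far. -/
structure OnlineAlgorithm (V : Type*) (k : ℕ) where
  /-- the configuration after serving `ρ`, starting in `A₀` -/
  config : Config V k → List V → Config V k
  config_nil : ∀ A₀ : Config V k, config A₀ [] = A₀
  serves : ∀ (A₀ : Config V k) (ρ : List V) (r : V), r ∈ (config A₀ (ρ ++ [r])).1

/-- The total cost paid by an online algorithm for serving `ρ` when it starts in `A₀`. -/
noncomputable def OnlineAlgorithm.cost {V : Type*} [MetricSpace V] {k : ℕ}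
    (A : OnlineAlgorithm V k) (A₀ : Config V k) (ρ : List V) : ℝ :=
  moveCost (fun i => A.config A₀ (ρ.take i)) ρ.length

/-- `c`-competitive with additive constant zero. -/
def OnlineAlgorithm.IsStrictlyCompetitive {V : Type*} [MetricSpace V] {k : ℕ}
    (A : OnlineAlgorithm V k) (c : ℝ) : Prop :=
  ∀ (A₀ : Config V k) (ρ : List V), A.cost A₀ ρ ≤ c * optCost A₀ ρ

open Classical in
/-- `Y` arises from `X` by moving the server at `a` to the request `r`. As `Y` is a set of `k`
points, this forces `a = r` (an empty move) whenever `r` is already occupied. -/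
def IsForcedMove {V : Type*} {k : ℕ} (X : Config V k) (a r : V) (Y : Config V k) : Prop :=
  a ∈ X.1 ∧ Y.1 = insert r (X.1.erase a)

/-- `A` is the Work Function Algorithm (with some rule for breaking ties): in configuration `X`
after serving `ρ`, it serves the request `r` by moving to `r` a server whose position `a ∈ X`
minimizes the sum of the work function `w_ρ` at the resulting configuration and of the distance
between `a` and `r`. -/
def OnlineAlgorithm.IsWorkFunctionAlgorithm {V : Type*} [MetricSpace V] {k : ℕ}
    (A : OnlineAlgorithm V k) : Prop :=
  ∀ (A₀ : Config V k) (ρ : List V) (r : V),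
    ∃ a : V, IsForcedMove (A.config A₀ ρ) a r (A.config A₀ (ρ ++ [r])) ∧
      ∀ (b : V) (Y : Config V k), IsForcedMove (A.config A₀ ρ) b r Y →
        workFunction A₀ ρ (A.config A₀ (ρ ++ [r])) + dist a r ≤ workFunction A₀ ρ Y + dist b r

end KServer

namespace KServer

open Equiv Function

/-! ### Work functions on tuples and their quasi-convexity. -/

section Tuples

variable {V : Type*} [MetricSpace V] {k : ℕ}

/-! Work functions are extended to `k`-tuples with repetitions. There they are quasi-convex: some
bijection between two tuples lets any set of matched pairs be swapped without raising the sum of the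
two values, and every request preserves this (`IsQuasiConvexWork.workStep`).

By the choice of the server, the cost of a step plus the increase of the work function along the
trajectory is at most the extended cost, the rise of the work function at the old configuration.
Each request raises the minimum of `potential` over `u` and `b` by at least the extended cost at any
tuple (`exists_potential_le_workStep`, from `exists_duality`).

That minimum is initially at least `-∑ i, ∑ j, dist (a i) (a j)`. Finally it is at most its value at
`u = b l = x`, namely `2 * k * w x - ∑ i, ∑ j, dist (x i) (x j)`. The two distance sums differ by at
most `(2 * k - 2) * matchCost a x`, hence by at most `(2 * k - 2) * w x`. This gives the factor `4 *
k - 2` with no additive constant. -/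

/-- The minimum weight of a perfect matching between two `k`-tuples of points. -/
noncomputable def matchCost (x y : Fin k → V) : ℝ :=
  ⨅ σ : Perm (Fin k), ∑ i, dist (x i) (y (σ i))

/-- The update of a work function on `k`-tuples when `r` is requested. -/
noncomputable def workStep (w : (Fin k → V) → ℝ) (r : V) (x : Fin k → V) : ℝ :=
  ⨅ i, (w (update x i r) + dist (x i) r)

/-- The work function on `k`-tuples (in which points may be repeated). -/
noncomputable def tupleWork (a : Fin k → V) (ρ : List V) : (Fin k → V) → ℝ :=
  ρ.foldl workStep (matchCost a)

theorem tupleWork_nil (a : Fin k → V) : tupleWork a [] = matchCost a := rfl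

theorem tupleWork_concat (a : Fin k → V) (ρ : List V) (r : V) :
    tupleWork a (ρ ++ [r]) = workStep (tupleWork a ρ) r := by
  simp [tupleWork]

theorem exists_matchCost_eq (x y : Fin k → V) :
    ∃ σ : Perm (Fin k), matchCost x y = ∑ i, dist (x i) (y (σ i)) := by
  obtain ⟨σ, h⟩ := exists_eq_ciInf_of_finite
    (f := fun σ : Perm (Fin k) => ∑ i, dist (x i) (y (σ i)))
  exact ⟨σ, h.symm⟩

theorem matchCost_le (x y : Fin k → V) (σ : Perm (Fin k)) :
    matchCost x y ≤ ∑ i, dist (x i) (y (σ i)) :=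
  ciInf_le (Set.finite_range _).bddBelow σ

theorem matchCost_nonneg (x y : Fin k → V) : 0 ≤ matchCost x y := by
  obtain ⟨σ, h⟩ := exists_matchCost_eq x y
  rw [h]
  positivity

theorem matchCost_self_le (x : Fin k → V) : matchCost x x ≤ 0 := by
  simpa using matchCost_le x x 1

theorem workStep_le (w : (Fin k → V) → ℝ) (r : V) (x : Fin k → V) (i : Fin k) :
    workStep w r x ≤ w (update x i r) + dist (x i) r :=
  ciInf_le (Set.finite_range fun i => w (update x i r) + dist (x i) r).bddBelow i

theorem exists_workStep_eq [NeZero k] (w : (Fin k → V) → ℝ) (r : V) (x : Fin k → V) :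
    ∃ i, workStep w r x = w (update x i r) + dist (x i) r := by
  obtain ⟨i, h⟩ := exists_eq_ciInf_of_finite
    (f := fun i => w (update x i r) + dist (x i) r)
  exact ⟨i, h.symm⟩

theorem workStep_le_self (w : (Fin k → V) → ℝ) (x : Fin k → V) (i : Fin k) :
    workStep w (x i) x ≤ w x := by
  simpa using workStep_le w (x i) x i

/-- The properties of work functions on which the competitive analysis rests: invariance under
permutations, the Lipschitz property, and quasi-convexity. -/
structure IsQuasiConvexWork (w : (Fin k → V) → ℝ) : Prop where
  perm : ∀ (σ : Perm (Fin k)) (x : Fin k → V), w (x ∘ σ) = w x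
  lipschitz : ∀ (x : Fin k → V) (i : Fin k) (r : V), w (update x i r) ≤ w x + dist (x i) r
  exchange : ∀ x y : Fin k → V, ∃ σ : Perm (Fin k), ∀ S : Finset (Fin k),
    w (S.piecewise x (y ∘ σ)) + w (S.piecewise (y ∘ σ) x) ≤ w x + w y

namespace IsQuasiConvexWork

variable {w : (Fin k → V) → ℝ}

theorem le_update_add (hw : IsQuasiConvexWork w) (x : Fin k → V) (i : Fin k) (r : V) :
    w x ≤ w (update x i r) + dist (x i) r := by
  have h := hw.lipschitz (update x i r) i (x i)
  simpa [dist_comm] using h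

theorem le_workStep [NeZero k] (hw : IsQuasiConvexWork w) (r : V) (x : Fin k → V) :
    w x ≤ workStep w r x := by
  obtain ⟨i, h⟩ := exists_workStep_eq w r x
  rw [h]
  exact hw.le_update_add x i r

theorem le_add_matchCost (hw : IsQuasiConvexWork w) (x y : Fin k → V) :
    w y ≤ w x + matchCost x y := by
  obtain ⟨σ, hσ⟩ := exists_matchCost_eq x y
  -- Points of `x` are moved to their partners one at a time.
  have key : ∀ S : Finset (Fin k),
      w (S.piecewise (y ∘ σ) x) ≤ w x + ∑ i ∈ S, dist (x i) (y (σ i)) := by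
    intro S
    induction S using Finset.induction_on with
    | empty => simp
    | insert i S hi ih =>
      rw [Finset.piecewise_insert, Finset.sum_insert hi]
      have h := hw.lipschitz (S.piecewise (y ∘ σ) x) i ((y ∘ σ) i)
      rw [Finset.piecewise_eq_of_notMem _ _ _ hi] at h
      simp only [comp_apply] at h ⊢
      linarith
  have h := key Finset.univ
  rw [Finset.piecewise_univ, hw.perm, ← hσ] at h
  exact h

/-- The bijection in the quasi-convexity property may be taken to match a common point of both
tuples with itself. -/
theorem exchange_of_eq (hw : IsQuasiConvexWork w) {x y : Fin k → V} {i j : Fin k}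
    (hij : x i = y j) : ∃ σ : Perm (Fin k), σ i = j ∧ ∀ S : Finset (Fin k),
    w (S.piecewise x (y ∘ σ)) + w (S.piecewise (y ∘ σ) x) ≤ w x + w y := by
  obtain ⟨σ, hσ⟩ := hw.exchange x y
  obtain ⟨l, rfl⟩ := σ.surjective j
  -- Re-pair `x i` with `y j` and `x l` with the old partner of `x i`. Since `x i = y j`, the new
  -- mixed tuples are, up to a permutation, old ones for the set that treats `i` as `l`.
  refine ⟨(swap i l).trans σ, by simp, fun S => ?_⟩
  by_cases hil : i = l
  · subst hil
    simpa using hσ S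
  have hli : l ≠ i := fun h => hil h.symm
  by_cases hl : l ∈ S
  · have h1 : S.piecewise x (y ∘ (swap i l).trans σ) = (insert i S).piecewise x (y ∘ σ) := by
      ext m
      by_cases hm : m = i <;> by_cases hm' : m = l <;> by_cases hS : m ∈ S <;>
        simp_all [Finset.piecewise, swap_apply_of_ne_of_ne]
    have h2 : S.piecewise (y ∘ (swap i l).trans σ) x
        = (insert i S).piecewise (y ∘ σ) x ∘ swap i l := by
      ext m
      by_cases hm : m = i <;> by_cases hm' : m = l <;> by_cases hS : m ∈ S <;>
        simp_all [Finset.piecewise, swap_apply_of_ne_of_ne]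
    rw [h1, h2, hw.perm]
    exact hσ _
  · have h1 : S.piecewise x (y ∘ (swap i l).trans σ)
        = (S.erase i).piecewise x (y ∘ σ) ∘ swap i l := by
      ext m
      by_cases hm : m = i <;> by_cases hm' : m = l <;> by_cases hS : m ∈ S <;>
        simp_all [Finset.piecewise, swap_apply_of_ne_of_ne]
    have h2 : S.piecewise (y ∘ (swap i l).trans σ) x = (S.erase i).piecewise (y ∘ σ) x := by
      ext m
      by_cases hm : m = i <;> by_cases hm' : m = l <;> by_cases hS : m ∈ S <;>
        simp_all [Finset.piecewise, swap_apply_of_ne_of_ne]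
    rw [h1, h2, hw.perm]
    exact hσ _

theorem workStep [NeZero k] (hw : IsQuasiConvexWork w) (r : V) :
    IsQuasiConvexWork (workStep w r) where
  perm σ x := by
    have hle : ∀ (σ : Perm (Fin k)) (x : Fin k → V),
        KServer.workStep w r (x ∘ σ) ≤ KServer.workStep w r x := by
      intro σ x
      obtain ⟨i, h⟩ := exists_workStep_eq w r x
      have h1 := workStep_le w r (x ∘ σ) (σ.symm i)
      have h2 : update (x ∘ σ) (σ.symm i) r = update x i r ∘ σ := by
        rw [update_comp_equiv]
      rw [h2, hw.perm] at h1
      simpa [h] using h1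
    refine le_antisymm (hle σ x) ?_
    have h := hle σ⁻¹ (x ∘ σ)
    have hx : (x ∘ σ) ∘ ⇑σ⁻¹ = x := by ext; simp
    rwa [hx] at h
  lipschitz x i s := by
    obtain ⟨j, h⟩ := exists_workStep_eq w r x
    have h1 := workStep_le w r (update x i s) j
    by_cases hj : j = i
    · subst hj
      simp only [update_idem, update_self] at h1
      have h2 := dist_triangle s (x j) r
      rw [dist_comm s (x j)] at h2
      linarith
    · rw [update_comm (Ne.symm hj), update_of_ne hj] at h1
      have h2 := hw.lipschitz (update x j r) i s
      rw [update_of_ne (Ne.symm hj)] at h2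
      linarith
  exchange x y := by
    -- Both optimal replacements contain `r`. With these two copies matched, each mixed tuple keeps
    -- `r` at position `i`, and restoring the original points costs `dist (x i) r + dist (y j) r` in
    -- total.
    obtain ⟨i, hi⟩ := exists_workStep_eq w r x
    obtain ⟨j, hj⟩ := exists_workStep_eq w r y
    obtain ⟨σ, hσi, hσ⟩ := hw.exchange_of_eq
      (x := update x i r) (y := update y j r) (i := i) (j := j) (by simp)
    refine ⟨σ, fun S => ?_⟩
    have hy : update y j r ∘ σ = update (y ∘ σ) i r := by
      rw [← hσi, update_comp_equiv, symm_apply_apply]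
    have h := hσ S
    have h1 : S.piecewise (update x i r) (update (y ∘ σ) i r)
        = update (S.piecewise x (y ∘ σ)) i r := by
      ext m
      by_cases hm : m = i <;> simp_all [Finset.piecewise]
    have h2 : S.piecewise (update (y ∘ σ) i r) (update x i r)
        = update (S.piecewise (y ∘ σ) x) i r := by
      ext m
      by_cases hm : m = i <;> simp_all [Finset.piecewise]
    rw [hy, h1, h2] at h
    have h3 := workStep_le w r (S.piecewise x (y ∘ σ)) i
    have h4 := workStep_le w r (S.piecewise (y ∘ σ) x) i
    subst hσi
    by_cases hS : i ∈ S
    · simp only [Finset.piecewise_eq_of_mem _ _ _ hS, comp_apply] at h3 h4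
      linarith
    · simp only [Finset.piecewise_eq_of_notMem _ _ _ hS, comp_apply] at h3 h4
      linarith

/-- Duality: the extended cost of a request `r` at any tuple `y` is at most the increase of the
minimum of `w z - ∑ j, dist r (z j)`. -/
theorem exists_duality [NeZero k] (hw : IsQuasiConvexWork w) (r : V) (x y : Fin k → V) :
    ∃ z : Fin k → V, w z - ∑ j, dist r (z j) + (KServer.workStep w r y - w y)
      ≤ KServer.workStep w r x - ∑ j, dist r (x j) := by
  obtain ⟨i, hi⟩ := exists_workStep_eq w r x
  obtain ⟨σ, hσ⟩ := hw.exchange (update x i r) y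
  -- Only position `i` is exchanged: `r` enters `y`, and the point it displaces enters `x`.
  have h := hσ (Finset.univ.erase i)
  have h1 : (Finset.univ.erase i).piecewise (update x i r) (y ∘ σ) = update x i (y (σ i)) := by
    ext m
    by_cases hm : m = i
    · subst hm; simp [Finset.piecewise]
    · simp [Finset.piecewise, hm]
  have h2 : (Finset.univ.erase i).piecewise (y ∘ σ) (update x i r) = update y (σ i) r ∘ σ := by
    ext m
    by_cases hm : m = i
    · subst hm; simp [Finset.piecewise]
    · simp [Finset.piecewise, hm]
  rw [h1, h2, hw.perm] at h
  refine ⟨update x i (y (σ i)), ?_⟩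
  have h3 := workStep_le w r y (σ i)
  have h4 : ∑ j, dist r (update x i (y (σ i)) j)
      = ∑ j, dist r (x j) - dist r (x i) + dist r (y (σ i)) := by
    rw [← Finset.add_sum_erase _ _ (Finset.mem_univ i),
      ← Finset.add_sum_erase _ (fun j => dist r (x j)) (Finset.mem_univ i),
      Finset.sum_congr rfl (g := fun j => dist r (x j)) fun j hj => by
        rw [update_of_ne (Finset.ne_of_mem_erase hj)]]
    simp
    ring
  rw [dist_comm (x i)] at hi
  rw [dist_comm (y (σ i))] at h3
  linarith

end IsQuasiConvexWork

theorem isQuasiConvexWork_matchCost (a : Fin k → V) : IsQuasiConvexWork (matchCost a) where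
  perm τ x := by
    have hle : ∀ (τ : Perm (Fin k)) (x : Fin k → V), matchCost a (x ∘ τ) ≤ matchCost a x := by
      intro τ x
      obtain ⟨σ, h⟩ := exists_matchCost_eq a x
      rw [h]
      simpa using matchCost_le a (x ∘ τ) (τ⁻¹ * σ)
    refine le_antisymm (hle τ x) ?_
    have h := hle τ⁻¹ (x ∘ τ)
    have hx : (x ∘ τ) ∘ ⇑τ⁻¹ = x := by ext; simp
    rwa [hx] at h
  lipschitz x i r := by
    obtain ⟨σ, h⟩ := exists_matchCost_eq a x
    obtain ⟨l, rfl⟩ := σ.surjective i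
    rw [h]
    refine (matchCost_le a _ σ).trans ?_
    rw [← Finset.add_sum_erase _ _ (Finset.mem_univ l),
      ← Finset.add_sum_erase _ (fun j => dist (a j) (x (σ j))) (Finset.mem_univ l),
      Finset.sum_congr rfl (g := fun j => dist (a j) (x (σ j))) fun j hj => by
        rw [update_of_ne (σ.injective.ne (Finset.ne_of_mem_erase hj))]]
    have := dist_triangle (a l) (x (σ l)) r
    simp only [update_self]
    linarith
  exchange x y := by
    obtain ⟨σ, hσ⟩ := exists_matchCost_eq a x
    obtain ⟨τ, hτ⟩ := exists_matchCost_eq a y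
    -- Pair the points matched to the same `a i`; swapping them merely interchanges summands.
    refine ⟨τ * σ⁻¹, fun S => ?_⟩
    have h1 := matchCost_le a (S.piecewise x (y ∘ ⇑(τ * σ⁻¹))) σ
    have h2 := matchCost_le a (S.piecewise (y ∘ ⇑(τ * σ⁻¹)) x) σ
    refine (add_le_add h1 h2).trans (le_of_eq ?_)
    rw [hσ, hτ, ← Finset.sum_add_distrib, ← Finset.sum_add_distrib]
    refine Finset.sum_congr rfl fun i _ => ?_
    by_cases hi : σ i ∈ S
    · simp [Finset.piecewise, hi]
    · simp [Finset.piecewise, hi, add_comm]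

theorem isQuasiConvexWork_tupleWork [NeZero k] (a : Fin k → V) (ρ : List V) :
    IsQuasiConvexWork (tupleWork a ρ) := by
  induction ρ using List.reverseRecOn with
  | nil => exact isQuasiConvexWork_matchCost a
  | append_singleton ρ r ih =>
    rw [tupleWork_concat]
    exact ih.workStep r

theorem matchCost_le_tupleWork [NeZero k] (a : Fin k → V) (ρ : List V) (x : Fin k → V) :
    matchCost a x ≤ tupleWork a ρ x := by
  induction ρ using List.reverseRecOn with
  | nil => exact le_rfl
  | append_singleton ρ r ih =>
    rw [tupleWork_concat]
    exact ih.trans ((isQuasiConvexWork_tupleWork a ρ).le_workStep r x)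

/-! ### The potential function. -/

/-- The potential whose minimum over all `u` and `b` increases, with each request, by at least
the extended cost. -/
noncomputable def potential (w : (Fin k → V) → ℝ) (u : Fin k → V) (b : Fin k → Fin k → V) : ℝ :=
  k * w u + ∑ l, (w (b l) - ∑ j, dist (u l) (b l j))

theorem exists_potential_le_workStep [NeZero k] {w : (Fin k → V) → ℝ} (hw : IsQuasiConvexWork w)
    (r : V) (y u : Fin k → V) (b : Fin k → Fin k → V) :
    ∃ (u' : Fin k → V) (b' : Fin k → Fin k → V),
      potential w u' b' + (workStep w r y - w y) ≤ potential (workStep w r) u b := by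
  obtain ⟨i, hi⟩ := exists_workStep_eq w r u
  obtain ⟨z, hz⟩ := hw.exists_duality r (b i) y
  -- The factor `k` before `w u` supplies the `k * dist (u i) r` lost when `u i` is replaced by `r`
  -- in the distances to `b i`.
  refine ⟨update u i r, update b i z, ?_⟩
  unfold potential
  rw [← Finset.add_sum_erase _ _ (Finset.mem_univ i),
    ← Finset.add_sum_erase _ (fun l => workStep w r (b l) - ∑ j, dist (u l) (b l j))
      (Finset.mem_univ i)]
  have h1 : ∑ l ∈ Finset.univ.erase i,
        (w (update b i z l) - ∑ j, dist (update u i r l) (update b i z l j))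
      ≤ ∑ l ∈ Finset.univ.erase i, (workStep w r (b l) - ∑ j, dist (u l) (b l j)) := by
    refine Finset.sum_le_sum fun l hl => ?_
    rw [update_of_ne (Finset.ne_of_mem_erase hl), update_of_ne (Finset.ne_of_mem_erase hl)]
    exact sub_le_sub_right (hw.le_workStep r (b l)) _
  have h2 : ∑ j, dist (u i) (b i j) ≤ k * dist (u i) r + ∑ j, dist r (b i j) := by
    calc ∑ j, dist (u i) (b i j) ≤ ∑ j, (dist (u i) r + dist r (b i j)) :=
          Finset.sum_le_sum fun j _ => dist_triangle _ _ _
      _ = _ := by simp [Finset.sum_add_distrib]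
  simp only [update_self]
  rw [hi, mul_add]
  linarith

/-- The route from `u (σ i)` through `a i` and `a j` to the partner of `a j` bounds each distance;
the two matching costs in the potential pay for its ends. -/
theorem le_potential_matchCost (a u : Fin k → V) (b : Fin k → Fin k → V) :
    -∑ i, ∑ j, dist (a i) (a j) ≤ potential (matchCost a) u b := by
  obtain ⟨σ, hσ⟩ := exists_matchCost_eq a u
  have h1 : ∀ i, -(k * dist (a i) (u (σ i))) - ∑ j, dist (a i) (a j)
      ≤ matchCost a (b (σ i)) - ∑ j, dist (u (σ i)) (b (σ i) j) := by
    intro i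
    obtain ⟨τ, hτ⟩ := exists_matchCost_eq a (b (σ i))
    have h2 : ∑ j, dist (u (σ i)) (b (σ i) j) ≤ ∑ j, (dist (a i) (u (σ i)) + dist (a i) (a j)
        + dist (a j) (b (σ i) (τ j))) := by
      rw [← Equiv.sum_comp τ]
      refine Finset.sum_le_sum fun j _ => ?_
      rw [dist_comm (a i) (u (σ i))]
      exact dist_triangle4 _ _ _ _
    rw [Finset.sum_add_distrib, Finset.sum_add_distrib, ← hτ] at h2
    simp only [Finset.sum_const, Finset.card_univ, Fintype.card_fin, nsmul_eq_mul] at h2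
    linarith
  have h3 := Finset.sum_le_sum fun i (_ : i ∈ Finset.univ) => h1 i
  rw [Equiv.sum_comp σ fun l => matchCost a (b l) - ∑ j, dist (u l) (b l j),
    Finset.sum_sub_distrib, Finset.sum_neg_distrib, ← Finset.mul_sum, ← hσ] at h3
  unfold potential
  linarith

theorem potential_diagonal (w : (Fin k → V) → ℝ) (x : Fin k → V) :
    potential w x (fun _ => x) = 2 * k * w x - ∑ i, ∑ j, dist (x i) (x j) := by
  simp only [potential, Finset.sum_sub_distrib, Finset.sum_const, Finset.card_univ,
    Fintype.card_fin, nsmul_eq_mul]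
  ring

/-- Each point of `a` moves to its partner in `x`. The diagonal terms vanish, which saves `2` in the
coefficient. -/
theorem sum_dist_le_add_matchCost (a x : Fin k → V) :
    ∑ i, ∑ j, dist (a i) (a j)
      ≤ ∑ i, ∑ j, dist (x i) (x j) + (2 * k - 2) * matchCost a x := by
  obtain ⟨σ, hσ⟩ := exists_matchCost_eq a x
  set e : Fin k → ℝ := fun i => dist (a i) (x (σ i)) with he
  have h1 : ∀ i j, dist (a i) (a j)
      ≤ dist (x (σ i)) (x (σ j)) + e i + e j - if i = j then 2 * e i else 0 := by
    intro i j
    by_cases hij : i = j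
    · subst hij
      simp only [dist_self, if_true]
      linarith
    · have := dist_triangle4 (a i) (x (σ i)) (x (σ j)) (a j)
      rw [dist_comm (x (σ j)) (a j)] at this
      simp only [hij, if_false, he]
      linarith
  calc ∑ i, ∑ j, dist (a i) (a j)
      ≤ ∑ i, ∑ j, (dist (x (σ i)) (x (σ j)) + e i + e j - if i = j then 2 * e i else 0) :=
        Finset.sum_le_sum fun i _ => Finset.sum_le_sum fun j _ => h1 i j
    _ = ∑ i, ∑ j, dist (x (σ i)) (x (σ j)) + (2 * k - 2) * matchCost a x := by
        rw [hσ]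
        simp only [Finset.sum_sub_distrib, Finset.sum_add_distrib, Finset.sum_const,
          Finset.card_univ, Fintype.card_fin, nsmul_eq_mul, Finset.sum_ite_eq, Finset.mem_univ,
          if_true, ← Finset.mul_sum]
        ring
    _ = _ := by
        congr 1
        rw [Equiv.sum_comp σ fun i => ∑ j, dist (x i) (x (σ j))]
        exact Finset.sum_congr rfl fun i _ => Equiv.sum_comp σ fun j => dist (x i) (x j)

end Tuples

/-! ### From tuples to configurations. -/

section Configurations

variable {V : Type*} {k : ℕ}

/-- The tuple of points listed by an enumeration of a configuration. -/
def Config.tuple {X : Config V k} (e : Fin k ≃ {v // v ∈ X.1}) : Fin k → V := fun i => e i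

theorem Config.exists_enum (X : Config V k) : Nonempty (Fin k ≃ {v // v ∈ X.1}) :=
  ⟨(Finset.equivFinOfCardEq X.2).symm⟩

theorem configDist_eq_matchCost [MetricSpace V] {X Y : Config V k} (e : Fin k ≃ {v // v ∈ X.1})
    (f : Fin k ≃ {v // v ∈ Y.1}) :
    configDist X Y = matchCost (Config.tuple e) (Config.tuple f) := by
  unfold configDist matchCost
  refine ((Equiv.equivCongr e f).iInf_congr fun σ => ?_).symm
  rw [← Equiv.sum_comp e]
  simp [Config.tuple]

theorem configDist_nonneg [MetricSpace V] (X Y : Config V k) : 0 ≤ configDist X Y :=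
  Real.iInf_nonneg fun _ => Finset.sum_nonneg fun _ _ => dist_nonneg

theorem moveCost_nonneg [MetricSpace V] (C : ℕ → Config V k) (n : ℕ) : 0 ≤ moveCost C n :=
  Finset.sum_nonneg fun _ _ => configDist_nonneg _ _

theorem workFunction_le [MetricSpace V] {A₀ : Config V k} {ρ : List V} {X : Config V k}
    {C : ℕ → Config V k}
    (hC : IsExecution A₀ ρ X C) : workFunction A₀ ρ X ≤ moveCost C (ρ.length + 1) :=
  csInf_le ⟨0, by rintro _ ⟨C, _, rfl⟩; exact moveCost_nonneg _ _⟩ ⟨C, hC, rfl⟩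

theorem moveCost_congr [MetricSpace V] {C C' : ℕ → Config V k} {n : ℕ} (h : ∀ i ≤ n, C i = C' i) :
    moveCost C n = moveCost C' n :=
  Finset.sum_congr rfl fun i hi => by
    have := Finset.mem_range.1 hi
    rw [h i (by omega), h (i + 1) (by omega)]

theorem IsExecution.extend [MetricSpace V] {A₀ : Config V k} {ρ : List V} {r : V} {Y : Config V k}
    {C : ℕ → Config V k} (hC : IsExecution A₀ ρ Y C) (hr : r ∈ Y.1) (X : Config V k) :
    IsExecution A₀ (ρ ++ [r]) X (update C (ρ.length + 2) X) ∧
      moveCost (update C (ρ.length + 2) X) (ρ.length + 2)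
        = moveCost C (ρ.length + 1) + configDist Y X := by
  obtain ⟨h0, h1, h2⟩ := hC
  refine ⟨⟨by rw [update_of_ne (by omega), h0], fun i hi => ?_, by simp⟩, ?_⟩
  · rw [List.length_append, List.length_singleton] at hi
    rw [update_of_ne (by omega)]
    by_cases hi' : i < ρ.length
    · rw [List.getElem_append_left hi']
      exact h1 i hi'
    · obtain rfl : i = ρ.length := by omega
      simpa [h2] using hr
  · rw [moveCost, Finset.sum_range_succ, update_self, update_of_ne (by omega), h2]
    congr 1
    exact moveCost_congr fun i hi => update_of_ne (by omega) _ _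

theorem IsExecution.restrict {A₀ : Config V k} {ρ : List V} {r : V} {X : Config V k}
    {C : ℕ → Config V k} (hC : IsExecution A₀ (ρ ++ [r]) X C) :
    IsExecution A₀ ρ (C (ρ.length + 1)) C ∧ r ∈ (C (ρ.length + 1)).1 := by
  obtain ⟨h0, h1, -⟩ := hC
  refine ⟨⟨h0, fun i hi => ?_, rfl⟩, ?_⟩
  · have := h1 i (by rw [List.length_append]; omega)
    rwa [List.getElem_append_left hi] at this
  · simpa using h1 ρ.length (by simp)

theorem tupleWork_le_moveCost [MetricSpace V] [NeZero k] {A₀ : Config V k}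
    (e₀ : Fin k ≃ {v // v ∈ A₀.1})
    (ρ : List V) {X : Config V k} (e : Fin k ≃ {v // v ∈ X.1}) {C : ℕ → Config V k}
    (hC : IsExecution A₀ ρ X C) :
    tupleWork (Config.tuple e₀) ρ (Config.tuple e) ≤ moveCost C (ρ.length + 1) := by
  induction ρ using List.reverseRecOn generalizing X with
  | nil =>
    obtain ⟨h0, -, h1⟩ := hC
    simp only [List.length_nil, zero_add] at h1
    simp [moveCost, h0, h1, tupleWork_nil, configDist_eq_matchCost e₀ e]
  | append_singleton ρ r ih =>
    obtain ⟨hC', hr⟩ := hC.restrict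
    obtain ⟨f⟩ := Config.exists_enum (C (ρ.length + 1))
    have h1 := ih f hC'
    have hX : C (ρ.length + 1 + 1) = X := by simpa using hC.2.2
    rw [List.length_append, List.length_singleton, moveCost, Finset.sum_range_succ, hX,
      configDist_eq_matchCost f e]
    rw [moveCost] at h1
    refine le_trans ?_ (add_le_add_left h1 _)
    refine ((isQuasiConvexWork_tupleWork _ _).le_add_matchCost (Config.tuple f) _).trans ?_
    refine add_le_add_left ?_ _
    rw [tupleWork_concat]
    have hi := workStep_le_self (tupleWork (Config.tuple e₀) ρ) (Config.tuple f) (f.symm ⟨r, hr⟩)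
    simpa [Config.tuple] using hi

theorem IsForcedMove.exists_enum {X Y : Config V k} {a r : V} (h : IsForcedMove X a r Y)
    (e : Fin k ≃ {v // v ∈ X.1}) : ∃ (f : Fin k ≃ {v // v ∈ Y.1}) (i : Fin k),
      Config.tuple e i = a ∧ Config.tuple f = update (Config.tuple e) i r := by
  classical
  obtain ⟨ha, hY⟩ := h
  have hmem : ∀ v, v ∈ Y.1 ↔ v = r ∨ v ≠ a ∧ v ∈ X.1 := by
    intro v
    rw [hY, Finset.mem_insert, Finset.mem_erase]
  obtain ⟨i, hi⟩ := e.surjective ⟨a, ha⟩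
  have hne : ∀ j, j ≠ i → (e j : V) ≠ a := fun j hj hja =>
    hj (e.injective ((Subtype.ext hja).trans hi.symm))
  have ht : ∀ j, update (Config.tuple e) i r j ∈ Y.1 := by
    intro j
    rw [hmem]
    rcases eq_or_ne j i with rfl | hj
    · simp
    · rw [update_of_ne hj]
      exact Or.inr ⟨hne j hj, (e j).2⟩
  let t : Fin k → {v // v ∈ Y.1} := fun j => ⟨update (Config.tuple e) i r j, ht j⟩
  have hsurj : Surjective t := by
    rintro ⟨v, hv⟩
    rcases (hmem v).1 hv with rfl | ⟨hva, hvX⟩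
    · exact ⟨i, Subtype.ext (update_self _ _ _)⟩
    · obtain ⟨j, hj⟩ := e.surjective ⟨v, hvX⟩
      have hji : j ≠ i := by
        rintro rfl
        exact hva (congrArg Subtype.val (hj.symm.trans hi))
      exact ⟨j, Subtype.ext ((update_of_ne hji _ _).trans (congrArg Subtype.val hj))⟩
  have hbij : Bijective t :=
    (Fintype.bijective_iff_surjective_and_card t).2 ⟨hsurj, by simp [Y.2]⟩
  exact ⟨Equiv.ofBijective t hbij, i, congrArg Subtype.val hi, rfl⟩

theorem exists_isForcedMove_of_notMem {X : Config V k} {a r : V} (ha : a ∈ X.1) (hr : r ∉ X.1) :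
    ∃ Y, IsForcedMove X a r Y := by
  classical
  refine ⟨⟨insert r (X.1.erase a), ?_⟩, ha, ?_⟩
  · rw [Finset.card_insert_of_notMem (fun h => hr (Finset.mem_of_mem_erase h)),
      Finset.card_erase_add_one ha, X.2]
  · congr

theorem isForcedMove_self {X : Config V k} {r : V} (hr : r ∈ X.1) : IsForcedMove X r r X :=
  ⟨hr, by classical exact (Finset.insert_erase hr).symm.trans (by congr)⟩

/-- One of the ways to serve `r` by a forced move attains the updated work function. -/
theorem exists_isForcedMove_workStep_eq [MetricSpace V] [NeZero k] {w : (Fin k → V) → ℝ}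
    (hw : IsQuasiConvexWork w) {X : Config V k} (e : Fin k ≃ {v // v ∈ X.1}) (r : V) :
    ∃ (a : V) (Y : Config V k) (f : Fin k ≃ {v // v ∈ Y.1}), IsForcedMove X a r Y ∧
      w (Config.tuple f) + dist a r ≤ workStep w r (Config.tuple e) := by
  by_cases hr : r ∈ X.1
  -- An optimal update could repeat `r`; by monotonicity, not moving is no worse.
  · refine ⟨r, X, e, isForcedMove_self hr, ?_⟩
    simpa using hw.le_workStep r (Config.tuple e)
  · obtain ⟨i, hi⟩ := exists_workStep_eq w r (Config.tuple e)
    obtain ⟨Y, hY⟩ := exists_isForcedMove_of_notMem (e i).2 hr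
    obtain ⟨f, j, hj, hf⟩ := hY.exists_enum e
    obtain rfl : j = i := e.injective (Subtype.ext hj)
    refine ⟨_, Y, f, hY, ?_⟩
    rw [hi, hf]
    rfl

theorem IsForcedMove.configDist_le [MetricSpace V] {X Y : Config V k} {a r : V}
    (h : IsForcedMove X a r Y) :
    configDist X Y ≤ dist a r := by
  obtain ⟨e⟩ := X.exists_enum
  obtain ⟨f, i, rfl, hf⟩ := h.exists_enum e
  rw [configDist_eq_matchCost e f, hf]
  refine ((isQuasiConvexWork_matchCost _).lipschitz _ i r).trans ?_
  linarith [matchCost_self_le (Config.tuple e)]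

theorem configDist_comm [MetricSpace V] (X Y : Config V k) : configDist X Y = configDist Y X := by
  unfold configDist
  refine (Equiv.symmEquiv _ _).iInf_congr fun σ => ?_
  rw [← Equiv.sum_comp σ]
  simp [Equiv.symmEquiv, dist_comm]

theorem IsForcedMove.mem {X Y : Config V k} {a r : V} (h : IsForcedMove X a r Y) : r ∈ Y.1 := by
  classical
  rw [h.2]
  exact Finset.mem_insert_self _ _

theorem exists_execution_moveCost_le [MetricSpace V] [NeZero k] {A₀ : Config V k}
    (e₀ : Fin k ≃ {v // v ∈ A₀.1}) (ρ : List V) {X : Config V k} (e : Fin k ≃ {v // v ∈ X.1}) :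
    ∃ C, IsExecution A₀ ρ X C ∧
      moveCost C (ρ.length + 1) ≤ tupleWork (Config.tuple e₀) ρ (Config.tuple e) := by
  induction ρ using List.reverseRecOn generalizing X with
  | nil =>
    refine ⟨fun i => if i = 0 then A₀ else X, by simp [IsExecution], ?_⟩
    simp [moveCost, tupleWork_nil, configDist_eq_matchCost e₀ e]
  | append_singleton ρ r ih =>
    obtain ⟨a, Y, f, hY, h⟩ :=
      exists_isForcedMove_workStep_eq (isQuasiConvexWork_tupleWork (Config.tuple e₀) ρ) e r
    obtain ⟨C, hC, hcost⟩ := ih f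
    obtain ⟨hC', hcost'⟩ := hC.extend hY.mem X
    refine ⟨_, hC', ?_⟩
    rw [List.length_append, List.length_singleton, hcost', tupleWork_concat, configDist_comm]
    linarith [hY.configDist_le]

/-- Admitting repeated points does not lower the optimum at genuine configurations, so the tuple
estimates apply to the algorithm. -/
theorem workFunction_eq_tupleWork [MetricSpace V] [NeZero k] {A₀ : Config V k}
    (e₀ : Fin k ≃ {v // v ∈ A₀.1})
    (ρ : List V) {X : Config V k} (e : Fin k ≃ {v // v ∈ X.1}) :
    workFunction A₀ ρ X = tupleWork (Config.tuple e₀) ρ (Config.tuple e) := by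
  obtain ⟨C, hC, hcost⟩ := exists_execution_moveCost_le e₀ ρ e
  refine le_antisymm ((workFunction_le hC).trans hcost) (le_csInf ⟨_, C, hC, rfl⟩ ?_)
  rintro _ ⟨C', hC', rfl⟩
  exact tupleWork_le_moveCost e₀ ρ e hC'

/-! ### Cost of the algorithm. -/

theorem OnlineAlgorithm.cost_nil [MetricSpace V] (A : OnlineAlgorithm V k) (A₀ : Config V k) :
    A.cost A₀ [] = 0 := by
  simp [OnlineAlgorithm.cost, moveCost]

theorem OnlineAlgorithm.cost_concat [MetricSpace V] (A : OnlineAlgorithm V k)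
    (A₀ : Config V k) (ρ : List V)
    (r : V) : A.cost A₀ (ρ ++ [r])
      = A.cost A₀ ρ + configDist (A.config A₀ ρ) (A.config A₀ (ρ ++ [r])) := by
  rw [OnlineAlgorithm.cost, List.length_append, List.length_singleton, moveCost,
    Finset.sum_range_succ]
  congr 1
  · exact moveCost_congr fun i hi => by rw [List.take_append_of_le_length hi]
  · simp [List.take_of_length_le]

/-- The cost of a step of the Work Function Algorithm is at most the extended cost at its
configuration, minus the increase of the work function along its trajectory. -/
theorem OnlineAlgorithm.IsWorkFunctionAlgorithm.configDist_le [MetricSpace V] [NeZero k]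
    {A : OnlineAlgorithm V k}
    (hA : A.IsWorkFunctionAlgorithm) {A₀ : Config V k} (e₀ : Fin k ≃ {v // v ∈ A₀.1})
    (ρ : List V) (r : V) (e : Fin k ≃ {v // v ∈ (A.config A₀ ρ).1})
    (f : Fin k ≃ {v // v ∈ (A.config A₀ (ρ ++ [r])).1}) :
    configDist (A.config A₀ ρ) (A.config A₀ (ρ ++ [r]))
      ≤ tupleWork (Config.tuple e₀) (ρ ++ [r]) (Config.tuple e)
        - tupleWork (Config.tuple e₀) (ρ ++ [r]) (Config.tuple f) := by
  obtain ⟨a, ha, hmin⟩ := hA A₀ ρ r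
  obtain ⟨b, Y, g, hY, h⟩ :=
    exists_isForcedMove_workStep_eq (isQuasiConvexWork_tupleWork (Config.tuple e₀) ρ) e r
  have h1 := hmin b Y hY
  rw [workFunction_eq_tupleWork e₀ ρ f, workFunction_eq_tupleWork e₀ ρ g] at h1
  -- The new configuration contains `r`, so the request does not raise its work function.
  have h2 := workStep_le_self (tupleWork (Config.tuple e₀) ρ) (Config.tuple f)
    (f.symm ⟨r, ha.mem⟩)
  have h3 : Config.tuple f (f.symm ⟨r, ha.mem⟩) = r := by simp [Config.tuple]
  rw [h3] at h2
  rw [tupleWork_concat]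
  linarith [ha.configDist_le]

theorem OnlineAlgorithm.IsWorkFunctionAlgorithm.cost_add_le_potential [MetricSpace V] [NeZero k]
    {A : OnlineAlgorithm V k} (hA : A.IsWorkFunctionAlgorithm) {A₀ : Config V k}
    (e₀ : Fin k ≃ {v // v ∈ A₀.1}) (ρ : List V) (e : Fin k ≃ {v // v ∈ (A.config A₀ ρ).1})
    (u : Fin k → V) (b : Fin k → Fin k → V) :
    A.cost A₀ ρ + tupleWork (Config.tuple e₀) ρ (Config.tuple e)
        - ∑ i, ∑ j, dist (Config.tuple e₀ i) (Config.tuple e₀ j)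
      ≤ potential (tupleWork (Config.tuple e₀) ρ) u b := by
  induction ρ using List.reverseRecOn generalizing u b with
  | nil =>
    have h1 := le_potential_matchCost (Config.tuple e₀) u b
    have h2 : matchCost (Config.tuple e₀) (Config.tuple e) ≤ 0 := by
      rw [← configDist_eq_matchCost e₀ e, A.config_nil, configDist_eq_matchCost e₀ e₀]
      exact matchCost_self_le _
    rw [A.cost_nil, tupleWork_nil]
    linarith
  | append_singleton ρ r ih =>
    obtain ⟨f⟩ := Config.exists_enum (A.config A₀ ρ)
    obtain ⟨u', b', h⟩ := exists_potential_le_workStep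
      (isQuasiConvexWork_tupleWork (Config.tuple e₀) ρ) r (Config.tuple f) u b
    have h1 := ih f u' b'
    have h2 := hA.configDist_le e₀ ρ r f e
    rw [A.cost_concat]
    rw [tupleWork_concat] at h2 ⊢
    linarith

theorem OnlineAlgorithm.IsWorkFunctionAlgorithm.cost_le_mul_workFunction [MetricSpace V] [NeZero k]
    {A : OnlineAlgorithm V k} (hA : A.IsWorkFunctionAlgorithm) (A₀ : Config V k) (ρ : List V)
    (X : Config V k) : A.cost A₀ ρ ≤ (4 * k - 2) * workFunction A₀ ρ X := by
  obtain ⟨e₀⟩ := A₀.exists_enum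
  obtain ⟨e⟩ := (A.config A₀ ρ).exists_enum
  obtain ⟨f⟩ := X.exists_enum
  have hk : (1 : ℝ) ≤ k := by exact_mod_cast NeZero.one_le
  have h1 := hA.cost_add_le_potential e₀ ρ e (Config.tuple f) fun _ => Config.tuple f
  rw [potential_diagonal] at h1
  have h2 := sum_dist_le_add_matchCost (Config.tuple e₀) (Config.tuple f)
  have h3 := mul_le_mul_of_nonneg_left
    (matchCost_le_tupleWork (Config.tuple e₀) ρ (Config.tuple f))
    (by linarith : (0 : ℝ) ≤ 2 * k - 2)
  have h4 := (matchCost_nonneg _ _).trans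
    (matchCost_le_tupleWork (Config.tuple e₀) ρ (Config.tuple e))
  rw [workFunction_eq_tupleWork e₀ ρ f]
  linarith

end Configurations

end KServer

theorem mainTheorem2 {V : Type*} [MetricSpace V] (k : ℕ) (hk : 1 ≤ k)
    (A : KServer.OnlineAlgorithm V k) (hA : A.IsWorkFunctionAlgorithm) :
    A.IsStrictlyCompetitive (4 * (k : ℝ) - 2) := by
  intro A₀ ρ
  have : NeZero k := ⟨by omega⟩
  have : Nonempty (KServer.Config V k) := ⟨A₀⟩
  have hk' : (1 : ℝ) ≤ k := by exact_mod_cast hk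
  rw [KServer.optCost, Real.mul_iInf_of_nonneg (by linarith)]
  exact le_ciInf fun X => hA.cost_le_mul_workFunction A₀ ρ X
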